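/- Let $\Bbbk$ be a field, $R = \Bbbk[x_0,\ldots,x_n]$, and let $I \subseteq R$ be a nonzero monomial ideal. Let $\operatorname{maxAss}(I)$ be the set of associated primes of $I$ that are maximal with respect to inclusion, and for $P \in \operatorname{maxAss}(I)$ put $Q_{\subseteq P} = R \cap I R_P$ (the contraction to $R$ of the extension of $I$ to the localization $R_P$). For a monomial ideal $J$ let $\mathcal{L}(J) = \{\mathbf{a} \in \mathbb{N}^{n+1} : \mathbf{x}^{\mathbf{a}} \in J\}$, and let $$\mathcal{Q} = \bigcap_{P \in \operatorname{maxAss}(I)} \operatorname{conv}\big(\mathcal{L}(Q_{\subseteq P})\big) \subseteq \mathbb{R}^{n+1}$$ be the symbolic polyhedron of $I$. Let $\alpha(I)$ be the least degree $d$ with $I_d \neq 0$, and let $\alpha(\mathcal{Q}) = \min\{a_0 + \cdots + a_n : (a_0,\ldots,a_n) \in \mathcal{Q}\}$. Suppose that $Q_{\subseteq P}$ is integrally closed for every $P \in \operatorname{maxAss}(I)$; that is, $Q_{\subseteq P}$ contains every $f \in R$ satisfying an equation $f^d + c_1 f^{d-1} + \cdots + c_d = 0$ with $d \geq 1$ and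 $c_i \in Q_{\subseteq P}^{\,i}$ (for monomial ideals this is equivalent to $\operatorname{conv}(\mathcal{L}(Q_{\subseteq P})) \cap \mathbb{N}^{n+1} = \mathcal{L}(Q_{\subseteq P})$). If either $n \geq 3$ and $\alpha(I) \geq n+4$, or $n = 2$ and $\alpha(I) \geq 8$, then the minimum defining $\alpha(\mathcal{Q})$ is attained and $$\alpha(\mathcal{Q}) \geq \frac{\alpha(I) + n - 1}{n}.$$ -/

import Mathlib

open MvPolynomial

namespace SymbolicPolyhedron

/-- An ideal of a polynomial ring is a monomial ideal if it is generated by a set of monomials. -/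
def IsMonomialIdeal {σ k : Type*} [Field k] (I : Ideal (MvPolynomial σ k)) : Prop :=
  ∃ S : Set (σ →₀ ℕ), I = Ideal.span ((fun s => monomial s (1 : k)) '' S)

/-- `f` is integral over the ideal `J`: there is an equation
`f ^ d + c₁ f ^ (d - 1) + ⋯ + c_d = 0` with `d ≥ 1` and `c_i ∈ J ^ i`. -/
def IsIntegralOverIdeal {R : Type*} [CommRing R] (J : Ideal R) (f : R) : Prop :=
  ∃ (d : ℕ) (c : ℕ → R), 1 ≤ d ∧ (∀ i ∈ Finset.Icc 1 d, c i ∈ J ^ i) ∧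
    f ^ d + ∑ i ∈ Finset.Icc 1 d, c i * f ^ (d - i) = 0

/-- An ideal is integrally closed if it contains every ring element that is integral over it. -/
def IsIntegrallyClosedIdeal {R : Type*} [CommRing R] (J : Ideal R) : Prop :=
  ∀ f : R, IsIntegralOverIdeal J f → f ∈ J

/-- The associated primes of `I` (that is, of the module `R ⧸ I`) that are maximal with respect to
inclusion among the associated primes of `I`. -/
def maxAss {R : Type*} [CommRing R] (I : Ideal R) : Set (PrimeSpectrum R) :=
  {P | Maximal (fun J : Ideal R => J ∈ associatedPrimes R (R ⧸ I)) P.asIdeal}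

/-- The ideal `Q_{⊆ P} = R ∩ I R_P`, the contraction to `R` of the extension of `I` to the
localization of `R` at the prime `P`. -/
def contractionAt {R : Type*} [CommRing R] (I : Ideal R) (P : PrimeSpectrum R) : Ideal R :=
  (I.map (algebraMap R (Localization.AtPrime P.asIdeal))).comap
    (algebraMap R (Localization.AtPrime P.asIdeal))

/-- The exponent vectors of the monomials in `I`, as points of real affine space. -/
def latticePoints {σ k : Type*} [Field k] (I : Ideal (MvPolynomial σ k)) : Set (σ → ℝ) :=
  {v | ∃ a : σ →₀ ℕ, monomial a (1 : k) ∈ I ∧ v = fun i => (a i : ℝ)}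

/-- The symbolic polyhedron of `I`: the intersection, over the maximal associated primes `P` of `I`,
of the convex hulls of the exponent vectors of the monomials in `R ∩ I R_P`. -/
def symbolicPolyhedron {σ k : Type*} [Field k] (I : Ideal (MvPolynomial σ k)) : Set (σ → ℝ) :=
  ⋂ P ∈ maxAss I, convexHull ℝ (latticePoints (contractionAt I P))

/-- `α(I)`: the least degree of a nonzero homogeneous element of `I`. -/
noncomputable def alphaIdeal {σ k : Type*} [Field k] (I : Ideal (MvPolynomial σ k)) : ℕ :=
  sInf {d : ℕ | ∃ f ∈ I, f ≠ 0 ∧ f.IsHomogeneous d}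

/-- The set of all coordinate sums of points of `S`. -/
def coordSums {σ : Type*} [Fintype σ] (S : Set (σ → ℝ)) : Set ℝ :=
  (fun v => ∑ i, v i) '' S

/-- `α(S)`: the least coordinate sum of a point of `S` (the infimum, which is the minimum
whenever a minimum exists). -/
noncomputable def alphaPolyhedron {σ : Type*} [Fintype σ] (S : Set (σ → ℝ)) : ℝ :=
  sInf (coordSums S)

end SymbolicPolyhedron

namespace SymbolicPolyhedron

open scoped Pointwise

/-! Let `a` be a point of the symbolic polyhedron with least coordinate sum. Rounding its
coordinates up gives an integer vector `b` dominating `a`. Integral closedness puts `x^b` in each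
`contractionAt I P`, and these ideals intersect in `I`, so `α(I) ≤ |b| < |a| + n + 1`. The degree
hypotheses turn this into the stated bound. The least sum is attained because each Newton polyhedron
is a polytope plus the positive orthant, hence closed. -/

/-! ### Integer approximation of real convex weights -/

/-- Simultaneous Dirichlet approximation for finitely many nonnegative reals. -/
theorem exists_simultaneous_approx {ι : Type*} [Fintype ι] (w : ι → ℝ) (hw : ∀ i, 0 ≤ w i)
    {ε : ℝ} (hε : 0 < ε) :
    ∃ (N : ℕ) (m : ι → ℕ), 1 ≤ N ∧ ∀ i, |(N : ℝ) * w i - m i| < ε := by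
  obtain ⟨M, hM⟩ := exists_nat_one_div_lt hε
  have hM0 : (0 : ℝ) < (M : ℝ) + 1 := by positivity
  have hlt : ∀ (j : ℕ) (i : ι), ⌊((M : ℝ) + 1) * Int.fract ((j : ℝ) * w i)⌋₊ < M + 1 := by
    intro j i
    rw [Nat.floor_lt (mul_nonneg hM0.le (Int.fract_nonneg _))]
    push_cast
    nlinarith [Int.fract_lt_one ((j : ℝ) * w i)]
  -- Pigeonhole: two multiples of `w` have fractional parts in the same cell of side `1 / (M + 1)`;
  -- their difference gives `N`.
  obtain ⟨a, b, hab, hf⟩ := Finite.exists_ne_map_eq_of_infinite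
    (fun (j : ℕ) (i : ι) => (⟨_, hlt j i⟩ : Fin (M + 1)))
  wlog hlt' : a < b generalizing a b
  · exact this b a hab.symm hf.symm (lt_of_le_of_ne (not_lt.1 hlt') hab.symm)
  have hle : ∀ i, ⌊(a : ℝ) * w i⌋₊ ≤ ⌊(b : ℝ) * w i⌋₊ := fun i =>
    Nat.floor_le_floor (mul_le_mul_of_nonneg_right (by exact_mod_cast hlt'.le) (hw i))
  refine ⟨b - a, fun i => ⌊(b : ℝ) * w i⌋₊ - ⌊(a : ℝ) * w i⌋₊, by omega, fun i => ?_⟩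
  have hfl : ∀ j : ℕ, (⌊(j : ℝ) * w i⌋₊ : ℝ) = (j : ℝ) * w i - Int.fract ((j : ℝ) * w i) := by
    intro j
    rw [natCast_floor_eq_intCast_floor (mul_nonneg (Nat.cast_nonneg j) (hw i))]
    linarith [Int.floor_add_fract ((j : ℝ) * w i)]
  have hcell := congrArg Fin.val (congrFun hf i)
  simp only at hcell
  have ha0 := mul_nonneg hM0.le (Int.fract_nonneg ((a : ℝ) * w i))
  have hb0 := mul_nonneg hM0.le (Int.fract_nonneg ((b : ℝ) * w i))
  have h1 := Nat.floor_le ha0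
  have h2 := Nat.lt_floor_add_one (((M : ℝ) + 1) * Int.fract ((a : ℝ) * w i))
  have h3 := Nat.floor_le hb0
  have h4 := Nat.lt_floor_add_one (((M : ℝ) + 1) * Int.fract ((b : ℝ) * w i))
  rw [hcell] at h1 h2
  have h5 : ((M : ℝ) + 1) * |Int.fract ((b : ℝ) * w i) - Int.fract ((a : ℝ) * w i)| < 1 := by
    rw [mul_comm, ← lt_div_iff₀ hM0, abs_lt, neg_lt, lt_div_iff₀ hM0, lt_div_iff₀ hM0]
    constructor <;> linarith
  rw [Nat.cast_sub hlt'.le, Nat.cast_sub (hle i), hfl, hfl]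
  refine lt_trans ?_ hM
  rw [lt_div_iff₀ hM0]
  rw [mul_comm]
  refine lt_of_eq_of_lt ?_ h5
  congr 2
  ring

/-- An integer point dominating a convex combination of integer points has a positive multiple
dominating a sum of equally many of these points, counted with multiplicity. -/
theorem exists_nat_combination_le {ι τ : Type*} [Fintype ι] [Finite τ] (w : ι → ℝ)
    (hw : ∀ i, 0 ≤ w i) (hw1 : ∑ i, w i = 1) (z : ι → τ → ℕ) (b : τ → ℕ)
    (hb : ∀ t, ∑ i, w i * (z i t : ℝ) ≤ b t) :
    ∃ (N : ℕ) (m : ι → ℕ), 1 ≤ N ∧ ∑ i, m i = N ∧ ∀ t, ∑ i, m i * z i t ≤ N * b t := by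
  have := Fintype.ofFinite τ
  -- `C` bounds both the number of weights and every coordinate sum `∑ i, z i t`. Precision `1 / (C
  -- + 1)` keeps all errors below 1, so integrality makes the conclusions exact.
  set C : ℝ := ∑ i, (1 + ∑ t, (z i t : ℝ)) with hC
  have hC0 : 0 ≤ C := by positivity
  obtain ⟨N, m, hN, hm⟩ := exists_simultaneous_approx w hw (ε := 1 / (C + 1)) (by positivity)
  have hsum : ∀ c : ι → ℝ, (∀ i, 0 ≤ c i) → (∀ i, c i ≤ 1 + ∑ t, (z i t : ℝ)) →
      |(N : ℝ) * ∑ i, w i * c i - ∑ i, (m i : ℝ) * c i| < 1 := by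
    intro c hc0 hc
    calc |(N : ℝ) * ∑ i, w i * c i - ∑ i, (m i : ℝ) * c i|
        = |∑ i, ((N : ℝ) * w i - m i) * c i| := by
          rw [Finset.mul_sum, ← Finset.sum_sub_distrib]
          congr 1
          exact Finset.sum_congr rfl fun i _ => by ring
      _ ≤ ∑ i, |((N : ℝ) * w i - m i) * c i| := Finset.abs_sum_le_sum_abs _ _
      _ ≤ ∑ i, 1 / (C + 1) * (1 + ∑ t, (z i t : ℝ)) := by
          refine Finset.sum_le_sum fun i _ => ?_
          rw [abs_mul, abs_of_nonneg (hc0 i)]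
          exact mul_le_mul (hm i).le (hc i) (hc0 i) (by positivity)
      _ = C / (C + 1) := by rw [← Finset.mul_sum, ← hC]; ring
      _ < 1 := by rw [div_lt_one (by positivity)]; linarith
  refine ⟨N, m, hN, ?_, fun t => ?_⟩
  · have h := hsum (fun _ => 1) (fun _ => zero_le_one)
      (fun i => le_add_of_nonneg_right (by positivity))
    simp only [mul_one, hw1] at h
    rw [abs_lt] at h
    have h1 : ((∑ i, m i : ℕ) : ℝ) < (N : ℝ) + 1 := by push_cast; linarith
    have h2 : (N : ℝ) < ((∑ i, m i : ℕ) : ℝ) + 1 := by push_cast; linarith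
    have h1' : ∑ i, m i < N + 1 := by exact_mod_cast h1
    have h2' : N < ∑ i, m i + 1 := by exact_mod_cast h2
    omega
  · have h := hsum (fun i => (z i t : ℝ)) (fun i => by positivity) (fun i => by
      have := Finset.single_le_sum (f := fun t => (z i t : ℝ)) (fun _ _ => by positivity)
        (Finset.mem_univ t)
      linarith)
    rw [abs_lt] at h
    have h3 := mul_le_mul_of_nonneg_left (hb t) (Nat.cast_nonneg (α := ℝ) N)
    have h4 : ((∑ i, m i * z i t : ℕ) : ℝ) < ((N * b t : ℕ) : ℝ) + 1 := by push_cast; linarith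
    have h5 : ∑ i, m i * z i t < N * b t + 1 := by exact_mod_cast h4
    omega

/-! ### Integral closure and Newton polyhedra -/

theorem isIntegralOverIdeal_of_pow_mem {R : Type*} [CommRing R] {J : Ideal R} {f : R} {N : ℕ}
    (hN : 1 ≤ N) (h : f ^ N ∈ J ^ N) : IsIntegralOverIdeal J f := by
  refine ⟨N, fun i => if i = N then -f ^ N else 0, hN, fun i _ => ?_, ?_⟩
  · dsimp only
    split_ifs with hi
    · subst hi
      exact neg_mem h
    · exact zero_mem _
  · rw [Finset.sum_eq_single_of_mem N (Finset.mem_Icc.2 ⟨hN, le_rfl⟩)]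
    · simp
    · intro i _ hi
      simp [hi]

theorem monomial_mem_of_le {σ k : Type*} [Field k] {J : Ideal (MvPolynomial σ k)} {a b : σ →₀ ℕ}
    (hab : a ≤ b) (ha : monomial a (1 : k) ∈ J) : monomial b (1 : k) ∈ J := by
  rw [show monomial b (1 : k) = monomial (b - a) 1 * monomial a 1 by
    rw [monomial_mul, tsub_add_cancel_of_le hab, one_mul]]
  exact J.mul_mem_left _ ha

/-- An integrally closed ideal contains every monomial whose exponent vector dominates a point of
the Newton polyhedron of the ideal. -/
theorem IsIntegrallyClosedIdeal.monomial_mem {σ k : Type*} [Finite σ] [Field k]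
    {J : Ideal (MvPolynomial σ k)} (hJ : IsIntegrallyClosedIdeal J) {a : σ → ℝ}
    (ha : a ∈ convexHull ℝ (latticePoints J)) {b : σ →₀ ℕ} (hab : ∀ t, a t ≤ b t) :
    monomial b (1 : k) ∈ J := by
  obtain ⟨ι, _, w, z, hw, hw1, hz, rfl⟩ := mem_convexHull_iff_exists_fintype.1 ha
  choose y hyJ hyz using hz
  obtain ⟨N, m, hN, hmN, hm⟩ := exists_nat_combination_le w hw hw1 (fun i t => y i t) b
    (fun t => by
      refine le_of_eq_of_le ?_ (hab t)
      simp [Finset.sum_apply, hyz])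
  -- The `N`-th power of `x^b` is divisible by a product of `N` monomials of `J`.
  refine hJ _ (isIntegralOverIdeal_of_pow_mem hN ?_)
  rw [monomial_pow, one_pow]
  refine monomial_mem_of_le (a := ∑ i, m i • y i) (fun t => ?_) ?_
  · simpa [Finsupp.finsetSum_apply] using hm t
  · have hprod : monomial (∑ i, m i • y i) (1 : k) = ∏ i, monomial (y i) (1 : k) ^ m i := by
      simp_rw [monomial_pow, one_pow]
      exact monomial_sum_one _ _
    rw [hprod, ← hmN, ← Finset.prod_pow_eq_pow_sum]
    exact Ideal.prod_mem_prod fun i _ => Ideal.pow_mem_pow (hyJ i) _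

/-! ### Contractions at maximal associated primes -/

theorem exists_maxAss_le {R : Type*} [CommRing R] [IsNoetherianRing R] {I J : Ideal R}
    (hJ : J ∈ associatedPrimes R (R ⧸ I)) : ∃ P ∈ maxAss I, J ≤ P.asIdeal := by
  obtain ⟨K, hJK, hK⟩ := exists_maximal_ge_of_wellFoundedGT
    (fun J : Ideal R => J ∈ associatedPrimes R (R ⧸ I)) J hJ
  exact ⟨⟨K, IsAssociatedPrime.isPrime hK.prop⟩, hK, hJK⟩

theorem le_contractionAt {R : Type*} [CommRing R] (I : Ideal R) (P : PrimeSpectrum R) :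
    I ≤ contractionAt I P :=
  Ideal.le_comap_map

/-- An ideal of a Noetherian ring is the intersection of its contractions at the maximal associated
primes. -/
theorem mem_of_forall_mem_contractionAt {R : Type*} [CommRing R] [IsNoetherianRing R] {I : Ideal R}
    {f : R} (hf : ∀ P ∈ maxAss I, f ∈ contractionAt I P) : f ∈ I := by
  by_contra hfI
  obtain ⟨J, hJ, hle⟩ := exists_le_isAssociatedPrime_of_isNoetherianRing R
    (Ideal.Quotient.mk I f) (by rwa [Ne, Ideal.Quotient.eq_zero_iff_mem])
  obtain ⟨P, hP, hJP⟩ := exists_maxAss_le hJ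
  have h := hf P hP
  rw [contractionAt, Ideal.mem_comap,
    IsLocalization.algebraMap_mem_map_algebraMap_iff P.asIdeal.primeCompl] at h
  obtain ⟨s, hs, hsf⟩ := h
  -- The denominator `s` kills the class of `f`, so it lies in the associated prime `J ≤ P`,
  -- although `s ∉ P`.
  refine hs (hJP (hle ?_))
  rw [Submodule.mem_colon_singleton, Submodule.mem_bot]
  exact Ideal.Quotient.eq_zero_iff_mem.2 hsf

theorem maxAss_nonempty {R : Type*} [CommRing R] [IsNoetherianRing R] {I : Ideal R} (hI : I ≠ ⊤) :
    (maxAss I).Nonempty := by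
  by_contra h
  rw [Set.not_nonempty_iff_eq_empty] at h
  exact hI ((Ideal.eq_top_iff_one I).2 (mem_of_forall_mem_contractionAt (by simp [h])))

/-! ### Closedness and attainment of the minimum -/

theorem convexHull_range_natCast : convexHull ℝ (Set.range (Nat.cast : ℕ → ℝ)) = Set.Ici 0 := by
  refine Set.Subset.antisymm (convexHull_min ?_ (convex_Ici 0)) fun x hx => ?_
  · rintro _ ⟨m, rfl⟩
    exact Set.mem_Ici.2 (Nat.cast_nonneg m)
  · obtain ⟨m, hm⟩ := exists_nat_ge x
    exact (convex_convexHull ℝ (Set.range (Nat.cast : ℕ → ℝ))).ordConnected.out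
      (subset_convexHull ℝ _ ⟨0, Nat.cast_zero⟩) (subset_convexHull ℝ _ ⟨m, rfl⟩) ⟨hx, hm⟩

/-- Dickson's lemma: the minimal exponents form an antichain in a well-quasi-order, hence a finite
set. -/
theorem exists_finite_generating_latticePoints {σ k : Type*} [Finite σ] [Field k]
    (J : Ideal (MvPolynomial σ k)) : ∃ F : Set (σ → ℝ), F.Finite ∧
      latticePoints J = F + Set.univ.pi fun _ : σ => Set.range (Nat.cast : ℕ → ℝ) := by
  set L : Set (σ →₀ ℕ) := {a | monomial a (1 : k) ∈ J} with hL
  have hpwo : L.IsPWO := Set.isPWO_of_wellQuasiOrderedLE L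
  refine ⟨(fun a t => (a t : ℝ)) '' {a : σ →₀ ℕ | Minimal (· ∈ L) a},
    ((setOfPred_minimal_antichain _).finite_of_partiallyWellOrderedOn
      (hpwo.mono (setOfPred_minimal_subset _))).image _, ?_⟩
  ext v
  constructor
  · rintro ⟨a, ha, rfl⟩
    obtain ⟨z, hza, hz⟩ := hpwo.exists_le_minimal (show a ∈ L from ha)
    refine ⟨_, ⟨z, hz, rfl⟩, fun t => ((a t - z t : ℕ) : ℝ), fun t _ => ⟨_, rfl⟩, ?_⟩
    funext t
    simp [Nat.cast_sub (hza t)]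
  · rintro ⟨_, ⟨z, hz, rfl⟩, c, hc, rfl⟩
    choose m hm using fun t => hc t (Set.mem_univ t)
    refine ⟨z + Finsupp.equivFunOnFinite.symm m, monomial_mem_of_le le_self_add hz.prop, ?_⟩
    funext t
    simp [hm]

theorem isClosed_convexHull_latticePoints {σ k : Type*} [Finite σ] [Field k]
    (J : Ideal (MvPolynomial σ k)) : IsClosed (convexHull ℝ (latticePoints J)) := by
  obtain ⟨F, hF, hJ⟩ := exists_finite_generating_latticePoints J
  rw [hJ, convexHull_add, convexHull_pi, convexHull_range_natCast]
  exact (isClosed_set_pi fun _ _ => isClosed_Ici).add_left_of_isCompact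
    (hF.isCompact_convexHull (𝕜 := ℝ))

theorem nonneg_of_mem_convexHull_latticePoints {σ k : Type*} [Field k]
    {J : Ideal (MvPolynomial σ k)} {v : σ → ℝ} (hv : v ∈ convexHull ℝ (latticePoints J)) :
    0 ≤ v := by
  refine convexHull_min (t := Set.Ici 0) ?_ (convex_Ici 0) hv
  rintro _ ⟨a, _, rfl⟩ t
  exact Nat.cast_nonneg (a t)

theorem symbolicPolyhedron_nonempty {σ k : Type*} [Field k] {I : Ideal (MvPolynomial σ k)}
    (hI : IsMonomialIdeal I) (hI0 : I ≠ ⊥) : (symbolicPolyhedron I).Nonempty := by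
  obtain ⟨S, rfl⟩ := hI
  obtain ⟨s, hs⟩ : S.Nonempty := by
    by_contra h
    rw [Set.not_nonempty_iff_eq_empty] at h
    exact hI0 (by simp [h])
  exact ⟨_, Set.mem_iInter₂.2 fun P _ => subset_convexHull ℝ _
    ⟨s, le_contractionAt _ P (Ideal.subset_span ⟨s, hs, rfl⟩), rfl⟩⟩

theorem isLeast_sInf_coordSums {σ : Type*} [Fintype σ] {S : Set (σ → ℝ)} (hS : IsClosed S)
    (hne : S.Nonempty) (h0 : ∀ v ∈ S, 0 ≤ v) : IsLeast (coordSums S) (sInf (coordSums S)) := by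
  obtain ⟨u, hu⟩ := hne
  have hcont : Continuous fun v : σ → ℝ => ∑ i, v i := by fun_prop
  -- Nonnegative coordinates are bounded by their sum, so points no worse than `u` lie in a compact
  -- box.
  set K : Set (σ → ℝ) := S ∩ Set.Icc 0 fun _ => ∑ i, u i with hK
  have hmem : ∀ v ∈ S, ∑ i, v i ≤ ∑ i, u i → v ∈ K := fun v hv hvu =>
    ⟨hv, h0 v hv, fun t => (Finset.single_le_sum (fun i _ => h0 v hv i) (Finset.mem_univ t)).trans
      hvu⟩
  obtain ⟨x, hx, hmin⟩ := (isCompact_Icc.inter_left hS).exists_isMinOn ⟨u, hmem u hu le_rfl⟩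
    hcont.continuousOn
  have hle : IsLeast (coordSums S) (∑ i, x i) := by
    refine ⟨⟨x, hx.1, rfl⟩, ?_⟩
    rintro _ ⟨v, hv, rfl⟩
    rcases le_total (∑ i, v i) (∑ i, u i) with h | h
    · exact hmin (hmem v hv h)
    · exact (hmin (hmem u hu le_rfl)).trans h
  rwa [hle.csInf_eq]

theorem alphaIdeal_le_degree {σ k : Type*} [Field k] {I : Ideal (MvPolynomial σ k)} {b : σ →₀ ℕ}
    (hb : monomial b (1 : k) ∈ I) : alphaIdeal I ≤ b.degree :=
  Nat.sInf_le ⟨_, hb, by simp, isHomogeneous_monomial _ rfl⟩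

/-- Rounding up a point of the symbolic polyhedron gives a monomial of the ideal. -/
theorem alphaIdeal_lt_sum_add_card {σ k : Type*} [Fintype σ] [Nonempty σ] [Field k]
    {I : Ideal (MvPolynomial σ k)}
    (hclosed : ∀ P ∈ maxAss I, IsIntegrallyClosedIdeal (contractionAt I P)) {a : σ → ℝ}
    (ha : a ∈ symbolicPolyhedron I) (ha0 : 0 ≤ a) :
    (alphaIdeal I : ℝ) < ∑ i, a i + Fintype.card σ := by
  set b : σ →₀ ℕ := Finsupp.equivFunOnFinite.symm fun i => ⌈a i⌉₊ with hb
  have hbI : monomial b (1 : k) ∈ I := mem_of_forall_mem_contractionAt fun P hP =>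
    (hclosed P hP).monomial_mem (Set.mem_iInter₂.1 ha P hP) fun t => Nat.le_ceil (a t)
  have hα : (alphaIdeal I : ℝ) ≤ ∑ i, (b i : ℝ) := by
    rw [← Nat.cast_sum, ← Finsupp.degree_eq_sum]
    exact_mod_cast alphaIdeal_le_degree hbI
  refine hα.trans_lt ?_
  calc ∑ i, (b i : ℝ) < ∑ i, (a i + 1) :=
        Finset.sum_lt_sum_of_nonempty Finset.univ_nonempty fun i _ => Nat.ceil_lt_add_one (ha0 i)
    _ = ∑ i, a i + Fintype.card σ := by simp [Finset.sum_add_distrib]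

end SymbolicPolyhedron

/-- For a nonzero monomial ideal `I` of `k[x₀, …, xₙ]` such that `R ∩ I R_P` is integrally closed
for every maximal associated prime `P` of `I`: if `n ≥ 3` and `α(I) ≥ n + 4`, or `n = 2` and
`α(I) ≥ 8`, then the symbolic polyhedron `𝒬` of `I` has a point of least coordinate sum, and that
least coordinate sum `α(𝒬)` satisfies `α(𝒬) ≥ (α(I) + n - 1) / n`. -/
theorem mainTheorem12 {k : Type*} [Field k] (n : ℕ)
    (I : Ideal (MvPolynomial (Fin (n + 1)) k))
    (hI : SymbolicPolyhedron.IsMonomialIdeal I) (hI0 : I ≠ ⊥)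
    (hclosed : ∀ P ∈ SymbolicPolyhedron.maxAss I,
      SymbolicPolyhedron.IsIntegrallyClosedIdeal (SymbolicPolyhedron.contractionAt I P))
    (hn : (3 ≤ n ∧ n + 4 ≤ SymbolicPolyhedron.alphaIdeal I) ∨
      (n = 2 ∧ 8 ≤ SymbolicPolyhedron.alphaIdeal I)) :
    IsLeast (SymbolicPolyhedron.coordSums (SymbolicPolyhedron.symbolicPolyhedron I))
        (SymbolicPolyhedron.alphaPolyhedron (SymbolicPolyhedron.symbolicPolyhedron I)) ∧
      ((SymbolicPolyhedron.alphaIdeal I : ℝ) + (n : ℝ) - 1) / (n : ℝ) ≤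
        SymbolicPolyhedron.alphaPolyhedron (SymbolicPolyhedron.symbolicPolyhedron I) := by
  open SymbolicPolyhedron in
  have hItop : I ≠ ⊤ := by
    rintro rfl
    have h0 : alphaIdeal (⊤ : Ideal (MvPolynomial (Fin (n + 1)) k)) ≤ (0 : Fin (n + 1) →₀ ℕ).degree :=
      alphaIdeal_le_degree Submodule.mem_top
    rw [map_zero] at h0
    omega
  obtain ⟨P, hP⟩ := SymbolicPolyhedron.maxAss_nonempty hItop
  have hnonneg : ∀ v ∈ SymbolicPolyhedron.symbolicPolyhedron I, 0 ≤ v := fun v hv =>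
    SymbolicPolyhedron.nonneg_of_mem_convexHull_latticePoints (Set.mem_iInter₂.1 hv P hP)
  have hleast := SymbolicPolyhedron.isLeast_sInf_coordSums
    (S := SymbolicPolyhedron.symbolicPolyhedron I)
    (isClosed_biInter fun P _ => SymbolicPolyhedron.isClosed_convexHull_latticePoints
      (SymbolicPolyhedron.contractionAt I P))
    (SymbolicPolyhedron.symbolicPolyhedron_nonempty hI hI0) hnonneg
  refine ⟨hleast, ?_⟩
  obtain ⟨a, ha, hsum⟩ := hleast.1
  have hlt := SymbolicPolyhedron.alphaIdeal_lt_sum_add_card hclosed ha (hnonneg a ha)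
  change _ ≤ sInf _
  rw [← hsum]
  rw [Fintype.card_fin] at hlt
  push_cast at hlt
  have hn0 : (0 : ℝ) < n := by
    have : 0 < n := by omega
    exact_mod_cast this
  rw [div_le_iff₀ hn0]
  dsimp only
  -- Since `α(𝒬) > α(I) - n - 1`, it suffices that `(n - 1) α(I) ≥ n² + 2n - 1`. For `α(I) ≥ n + 4`
  -- the left side is at least `n² + 3n - 4`, enough once `n ≥ 3`; for `n = 2` the condition is
  -- `α(I) ≥ 7`.
  rcases hn with ⟨h3, hα⟩ | ⟨rfl, hα⟩
  · have h3' : (3 : ℝ) ≤ n := by exact_mod_cast h3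
    have hα' : (n : ℝ) + 4 ≤ SymbolicPolyhedron.alphaIdeal I := by exact_mod_cast hα
    nlinarith
  · have hα' : (8 : ℝ) ≤ SymbolicPolyhedron.alphaIdeal I := by exact_mod_cast hα
    push_cast at hlt ⊢
    linarith
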